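/- Let $k\ge 2$ and let $M_k^k$ be a nonsingular hypersurface of degree $k$ in $\mathbb{CP}^{k-1}$, with hyperplane class $h$ and holomorphic tangent bundle $T'M_k^k$. Its total Chern class is $c(T'M_k^k)=\frac{(1+h)^k}{1+kh}$, and $\int_{M_k^k}h^{k-2}=k$. Let $c_T(z)$ be the monomial in $z$ of degree $k-2$ with $c_T(h)=c_{k-2}(T'M_k^k)$, and let $\chi(M_k^k)=\int_{M_k^k}c_{k-2}(T'M_k^k)$ be the Euler number, so that $c_T(z)=\frac{\chi(M_k^k)}{k}z^{k-2}$. Put $e_k(x,y)=\prod_{j=0}^{k}(jx+(k-j)y)$. For $d\ge 1$ let $P_d$ be the set of partitions $\sigma=(d_1\ge\dots\ge d_l>0)$ of $d$, where $l=l(\sigma)$, and put $\mathrm{Sym}(\sigma)=\frac{(l-1)!}{\prod_{j=1}^{d}\mathrm{mul}(\sigma;j)!}$, where $\mathrm{mul}(\sigma;j)$ is the multiplicity of $j$ in $\sigma$. The graphs of type (i) of degree $d$ are the star graphs $\Gamma=\Gamma_\sigma$, one for each $\sigma\in P_d$: an elliptic vertex at the centre with variable $z_0$, and $l$ tails, the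 $i$-th one having $d_i$ edges and vertices with variables $z_{i,1},\dots,z_{i,d_i}$ (counted from the centre; $z_{i,0}=z_0$). The integrand of $\Gamma_\sigma$ (without operator insertions) is the rational function $$f_{\Gamma_\sigma}=\mathrm{Sym}(\sigma)\,\frac1{24}\,\frac{c_T(z_0)}{(kz_0)^{l-1}}\prod_{i=1}^{l}\frac{e_k(z_0,z_{i,1})}{z_{i,1}-z_0}\;\prod_{i=1}^{l}\prod_{j=1}^{d_i-1}\frac{e_k(z_{i,j},z_{i,j+1})}{(2z_{i,j}-z_{i,j-1}-z_{i,j+1})\,kz_{i,j}}\;\cdot\frac1{z_0^{k}}\prod_{i=1}^{l}\prod_{j=1}^{d_i}\frac1{z_{i,j}^{k}} .$$ Its residue $\mathrm{Res}(f_{\Gamma_\sigma})$ is defined as follows. First take the residue at $z_0=0$. Then, for each $i$ and in ascending order of $j=1,\dots,d_i-1$, replace the function by the sum of its residues in the variable $z_{i,j}$ at $z_{i,j}=0$ and at $z_{i,j}=\frac{z_{i,j-1}+z_{i,j+1}}2$, where $z_{i,j-1}$ stands for the value at which its own residue was taken; that is, by the sum of the residues at $z_{i,j}=\frac{m}{m+1}z_{i,j+1}$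 for $m=0,1,\dots,j$. For each $i$, finish with the residue at $z_{i,d_i}=0$. The tails are treated one after the other. Then every $\mathrm{Res}(f_{\Gamma_\sigma})$ is a rational number, and, as formal power series in $e^{x}$, $$\sum_{d=1}^{\infty}\Bigl(\sum_{\sigma\in P_d}\mathrm{Res}(f_{\Gamma_\sigma})\Bigr)e^{dx}=\frac{\chi(M_k^k)}{24}\,\log\tilde L_0^{k,k}(e^x),\qquad \tilde L_0^{k,k}(e^x)=\sum_{d=0}^{\infty}\frac{(kd)!}{(d!)^k}\,e^{dx}.$$ -/

import Mathlib

open scoped Nat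

noncomputable section

namespace StarGraph

/-! ### Rational functions in the vertex variables and their residues -/

/-- Vertices of star graphs: `none` is the central elliptic vertex, `some (i, j)` with `j ≥ 1` is
the `j`-th vertex, counted from the centre, of the `i`-th tail (tails are numbered from `0`). -/
abbrev Vertex : Type := Option (ℕ × ℕ)

/-- The field of rational functions over `ℂ` in one variable for each vertex. -/
abbrev K : Type := FractionRing (MvPolynomial Vertex ℂ)

/-- The variable attached to a vertex. -/
def Z (v : Vertex) : K := algebraMap (MvPolynomial Vertex ℂ) K (MvPolynomial.X v)

/-- The variable `z_{i,j}`, with the convention `z_{i,0} = z_0` (the variable of the centre). -/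
def z (i j : ℕ) : K := if j = 0 then Z none else Z (some (i, j))

/-- A polynomial in all the variables, read as a rational function of the variable of `v` alone,
the other variables being constants. -/
def univariatePoly (v : Vertex) : MvPolynomial Vertex ℂ →+* RatFunc K :=
  MvPolynomial.eval₂Hom (RatFunc.C.comp (algebraMap ℂ K))
    (fun u => if u = v then RatFunc.X else RatFunc.C (Z u))

theorem univariatePoly_injective (v : Vertex) : Function.Injective (univariatePoly v) := by
  let g : MvPolynomial Vertex ℂ →+* Polynomial K :=
    MvPolynomial.eval₂Hom (Polynomial.C.comp (algebraMap ℂ K))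
      (fun u => if u = v then Polynomial.X else Polynomial.C (Z u))
  have h1 : (Polynomial.evalRingHom (Z v)).comp g = algebraMap (MvPolynomial Vertex ℂ) K := by
    apply MvPolynomial.ringHom_ext
    · intro r
      simp only [g, RingHom.comp_apply, MvPolynomial.coe_eval₂Hom, MvPolynomial.eval₂_C,
        Polynomial.coe_evalRingHom, Polynomial.eval_C]
      exact IsScalarTower.algebraMap_apply ℂ (MvPolynomial Vertex ℂ) K r
    · intro u
      by_cases h : u = v
      · subst h
        simp [g, Z]
      · simp [g, Z, h]
  have h2 : (algebraMap (Polynomial K) (RatFunc K)).comp g = univariatePoly v := by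
    apply MvPolynomial.ringHom_ext
    · intro r
      simp [g, univariatePoly]
    · intro u
      by_cases h : u = v
      · simp [g, univariatePoly, h]
      · simp [g, univariatePoly, h]
  have h3 : Function.Injective g := by
    have h : Function.Injective ((Polynomial.evalRingHom (Z v)).comp g) := by
      rw [h1]
      exact IsFractionRing.injective (MvPolynomial Vertex ℂ) K
    rw [RingHom.coe_comp] at h
    exact h.of_comp
  rw [← h2, RingHom.coe_comp]
  exact (RatFunc.algebraMap_injective K).comp h3

/-- A rational function of all the variables, read as a rational function of the variable of `v`
alone, the other variables being constants. -/
def univariate (v : Vertex) : K →+* RatFunc K :=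
  IsFractionRing.lift (univariatePoly_injective v)

/-- The residue at `a` of a rational function `f` of one variable `t`: the coefficient of
`(t - a)⁻¹` in the Laurent expansion of `f` at `t = a`. -/
def ratFuncResidue {F : Type*} [Field F] (a : F) (f : RatFunc F) : F :=
  ((RatFunc.laurent a f : RatFunc F) : LaurentSeries F).coeff (-1)

/-- The residue of `F` at the point `a` in the variable of `v`; the point may depend on the other
variables. -/
def residue (v : Vertex) (a : K) (F : K) : K := ratFuncResidue a (univariate v F)

/-! ### Chern classes of a nonsingular hypersurface of degree `k` in `CP^{N-1}` -/

/-- The total Chern class `(1 + h)^N / (1 + k h)` of the holomorphic tangent bundle, written as a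
power series in the hyperplane class `h`. -/
def totalChern (N k : ℕ) : PowerSeries ℚ :=
  (1 + PowerSeries.X) ^ N * (1 + (k : PowerSeries ℚ) * PowerSeries.X)⁻¹

/-- The number `c` for which the top Chern class is `c · h^{N-2}`. -/
def topChernCoeff (N k : ℕ) : ℚ := PowerSeries.coeff (N - 2) (totalChern N k)

/-- Integration over the hypersurface of a class written in terms of `h`: only the top degree
`N - 2` contributes, and `h^{N-2}` has integral `k`. -/
def hypersurfaceIntegral (N k : ℕ) (p : PowerSeries ℚ) : ℚ := k * PowerSeries.coeff (N - 2) p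

/-- The Euler number: the integral of the top Chern class. -/
def eulerNumber (N k : ℕ) : ℚ :=
  hypersurfaceIntegral N k (PowerSeries.monomial (N - 2) (topChernCoeff N k))

/-- The monomial `c_T(x)`: the top Chern class with `h` replaced by `x`. -/
def cT (N k : ℕ) (x : K) : K := (topChernCoeff N k : K) * x ^ (N - 2)

/-! ### Integrands and residues of star graphs with an elliptic centre -/

/-- `e_k(x, y) = ∏_{j=0}^{k} (j x + (k - j) y)`. -/
def e (k : ℕ) (x y : K) : K :=
  ∏ j ∈ Finset.range (k + 1), ((j : K) * x + ((k : K) - (j : K)) * y)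

/-- The parts `d_1 ≥ d_2 ≥ ⋯ ≥ d_l` of a partition, in this order. -/
def partsList {d : ℕ} (σ : d.Partition) : List ℕ := σ.parts.sort (· ≥ ·)

/-- The length `l` of a partition. -/
def len {d : ℕ} (σ : d.Partition) : ℕ := (partsList σ).length

/-- The `i`-th part of a partition, numbered from `0`; it is the number of edges of the `i`-th tail
of the star graph of the partition. -/
def part {d : ℕ} (σ : d.Partition) (i : ℕ) : ℕ := (partsList σ).getD i 0

/-- The symmetry factor `(l - 1)! / ∏_{j=1}^{d} mul(σ; j)!`. -/
def symFactor {d : ℕ} (σ : d.Partition) : ℚ :=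
  ((len σ - 1)! : ℚ) / ∏ j ∈ Finset.Icc 1 d, ((σ.parts.count j)! : ℚ)

/-- The integrand, without operator insertions, of the star graph of `σ` with an elliptic vertex as
its centre, for a degree `k` hypersurface in `CP^{N-1}`. -/
def integrand (N k : ℕ) {d : ℕ} (σ : d.Partition) : K :=
  (symFactor σ : K) * (1 / 24) * (cT N k (Z none) / ((k : K) * Z none) ^ (len σ - 1))
    * (∏ i ∈ Finset.range (len σ), e k (Z none) (z i 1) / (z i 1 - Z none))
    * (∏ i ∈ Finset.range (len σ), ∏ j ∈ Finset.Icc 1 (part σ i - 1),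
        e k (z i j) (z i (j + 1)) /
          ((2 * z i j - z i (j - 1) - z i (j + 1)) * ((k : K) * z i j)))
    * (1 / Z none ^ N)
    * ∏ i ∈ Finset.range (len σ), ∏ j ∈ Finset.Icc 1 (part σ i), 1 / z i j ^ N

/-- The residues in `z_{i,1}, …, z_{i,n}`, in this order, each step adding up the residues at
`z_{i,j} = 0` and at `z_{i,j} = (z_{i,j-1} + z_{i,j+1}) / 2`. Here `z_{i,j-1}` has been eliminated
already: `z_{i,0} = 0`, and if `z_{i,j-1} = (m / (m + 1)) z_{i,j}`, then
`2 z_{i,j} = z_{i,j-1} + z_{i,j+1}` means `z_{i,j} = ((m + 1) / (m + 2)) z_{i,j+1}`. So the points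
for `z_{i,j}` are `(m / (m + 1)) z_{i,j+1}` with `0 ≤ m ≤ j`, that is
`0, z_{i,j+1} / 2, 2 z_{i,j+1} / 3, …`. -/
def innerResidue (i : ℕ) : ℕ → K → K
  | 0, F => F
  | n + 1, F =>
      ∑ m ∈ Finset.range (n + 2),
        residue (some (i, n + 1)) ((m : K) / ((m : K) + 1) * z i (n + 2)) (innerResidue i n F)

/-- The residues in all the variables of the `i`-th tail, which has `n ≥ 1` edges; the last one is
taken at `z_{i,n} = 0` only. -/
def tailResidue (i n : ℕ) (F : K) : K :=
  residue (some (i, n)) 0 (innerResidue i (n - 1) F)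

/-- The residue at `z_0 = 0`, followed by those in the variables of the first `l` tails, where the
`i`-th tail has `D i` edges. -/
def iteratedResidue (D : ℕ → ℕ) : ℕ → K → K
  | 0, F => residue none 0 F
  | l + 1, F => tailResidue l (D l) (iteratedResidue D l F)

/-- The residue `Res(f_Γ)` of the integrand of the star graph `Γ` of `σ` with elliptic centre. -/
def starResidue (N k : ℕ) {d : ℕ} (σ : d.Partition) : K :=
  iteratedResidue (part σ) (len σ) (integrand N k σ)

/-- The series `∑_{d ≥ 0} (k d)! / (d!)^k q^d`, where `q` stands for `e^x`. -/
def L0 (k : ℕ) : PowerSeries ℚ :=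
  PowerSeries.mk fun d => ((k * d)! : ℚ) / ((d ! : ℚ) ^ k)

end StarGraph

end

/-! Since e_k(x, y) contains the factor kx, the l tails contribute (k z_0)^l. Together with
c_T(z_0), (k z_0)^{l-1} and z_0^{-k} this leaves χ / z_0 (`integrand_eq`). The pole at z_0 = 0 is
therefore simple, its residue sets z_0 = 0 everywhere else, and the tails decouple
(`iteratedResidue_mul_prod_tailFactor`).

On one tail, let L_m be the coefficients of L̃_0 in q = e^x. After t residues there remains a
combination, over m ≤ t, of terms in which z_{i,t} has become (m/(m+1)) z_{i,t+1}. The next residue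
at 0 multiplies such a term by -L_1, the one at ratio (m+1)/(m+2) by L_{m+2}/L_{m+1}, and all others
vanish (`residue_inv_mul_chain`). The recursion is solved by the convolution identity for L̃_0 ·
L̃_0⁻¹ = 1, and a tail with n edges yields minus the q^n coefficient of L̃_0⁻¹
(`tailResidue_chain`), which is that of T = 1 - L̃_0⁻¹.

Finally Sym(σ) is 1/l times the number of orderings of the parts of σ, so summing over partitions
gives the q^d coefficient of ∑ T^l / l = -log(1 - T) = log L̃_0 (`sum_symFactor_mul`). -/

noncomputable section

namespace StarGraph

/-! ### Laurent expansions, regular values and simple poles. -/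

/-- The Laurent expansion at `a` of a rational function of one variable. -/
def ratFuncExpansion {F : Type*} [Field F] (a : F) : RatFunc F →+* LaurentSeries F where
  toFun f := ((RatFunc.laurent a f : RatFunc F) : LaurentSeries F)
  map_zero' := by simp only [map_zero]
  map_one' := by simp only [map_one]
  map_add' f g := by simp only [map_add]
  map_mul' f g := by simp only [map_mul]

theorem ratFuncExpansion_algebraMap {F : Type*} [Field F] (a : F) (p : Polynomial F) :
    ratFuncExpansion a (algebraMap _ _ p)
      = (((Polynomial.taylor a p : Polynomial F) : PowerSeries F) : LaurentSeries F) := by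
  rw [RatFunc.coe_coe]
  exact congrArg (fun f : RatFunc F => (f : LaurentSeries F)) (RatFunc.laurent_algebraMap a p)

theorem ratFuncExpansion_C {F : Type*} [Field F] (a b : F) :
    ratFuncExpansion a (RatFunc.C b) = ((PowerSeries.C b : PowerSeries F) : LaurentSeries F) := by
  rw [← RatFunc.algebraMap_C, ratFuncExpansion_algebraMap, Polynomial.taylor_C, Polynomial.coe_C]

theorem ratFuncExpansion_X {F : Type*} [Field F] (a : F) :
    ratFuncExpansion a RatFunc.X
      = ((PowerSeries.X + PowerSeries.C a : PowerSeries F) : LaurentSeries F) := by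
  rw [← RatFunc.algebraMap_X, ratFuncExpansion_algebraMap, Polynomial.taylor_X, Polynomial.coe_add,
    Polynomial.coe_C, Polynomial.coe_X]

theorem ratFuncResidue_eq_coeff {F : Type*} [Field F] (a : F) (f : RatFunc F) :
    ratFuncResidue a f = (ratFuncExpansion a f).coeff (-1) := rfl

/-- The Laurent expansion at `a` in the variable of `v`. -/
def expansion (v : Vertex) (a : K) : K →+* LaurentSeries K :=
  (ratFuncExpansion a).comp (univariate v)

theorem residue_eq_coeff (v : Vertex) (a F : K) :
    residue v a F = (expansion v a F).coeff (-1) := ratFuncResidue_eq_coeff a _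

/-- The rational functions that do not involve the variable of `v`. -/
def constants (v : Vertex) : Subfield K := (univariate v).eqLocusField RatFunc.C

theorem univariate_Z (u v : Vertex) :
    univariate v (Z u) = if u = v then RatFunc.X else RatFunc.C (Z u) := by
  simp [univariate, Z, univariatePoly]

theorem Z_mem_constants {u v : Vertex} (h : u ≠ v) : Z u ∈ constants v := by
  rw [constants, RingHom.mem_eqLocusField, univariate_Z, if_neg h]

theorem Z_notMem_constants (v : Vertex) : Z v ∉ constants v := by
  rw [constants, RingHom.mem_eqLocusField, univariate_Z, if_pos rfl, ← RatFunc.algebraMap_X,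
    ← RatFunc.algebraMap_C]
  intro h
  exact Polynomial.X_ne_C _ (RatFunc.algebraMap_injective K h)

theorem Z_ne_of_mem {v : Vertex} {a : K} (h : a ∈ constants v) : Z v ≠ a :=
  fun h' => Z_notMem_constants v (h' ▸ h)

theorem Z_ne_zero (v : Vertex) : Z v ≠ 0 := Z_ne_of_mem (zero_mem _)

theorem expansion_of_mem {v : Vertex} {F : K} (h : F ∈ constants v) (a : K) :
    expansion v a F = ((PowerSeries.C F : PowerSeries K) : LaurentSeries K) := by
  rw [constants, RingHom.mem_eqLocusField] at h
  rw [expansion, RingHom.comp_apply, h, ratFuncExpansion_C]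

theorem expansion_Z (v : Vertex) (a : K) :
    expansion v a (Z v)
      = ((PowerSeries.X + PowerSeries.C a : PowerSeries K) : LaurentSeries K) := by
  rw [expansion, RingHom.comp_apply, univariate_Z, if_pos rfl, ratFuncExpansion_X]

/-- `F` is regular at `a` in the variable of `v`, with value `b`. -/
def HasValueAt (v : Vertex) (a F b : K) : Prop :=
  ∃ p : PowerSeries K, expansion v a F = (p : LaurentSeries K) ∧ PowerSeries.constantCoeff p = b

namespace HasValueAt

variable {v : Vertex} {a F G b c : K}

theorem of_mem (h : F ∈ constants v) : HasValueAt v a F F :=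
  ⟨_, expansion_of_mem h a, by simp⟩

theorem var (v : Vertex) (a : K) : HasValueAt v a (Z v) a :=
  ⟨_, expansion_Z v a, by simp⟩

theorem add (hF : HasValueAt v a F b) (hG : HasValueAt v a G c) :
    HasValueAt v a (F + G) (b + c) := by
  obtain ⟨p, hp, rfl⟩ := hF
  obtain ⟨q, hq, rfl⟩ := hG
  exact ⟨p + q, by rw [map_add, hp, hq, PowerSeries.coe_add], map_add _ _ _⟩

theorem sub (hF : HasValueAt v a F b) (hG : HasValueAt v a G c) :
    HasValueAt v a (F - G) (b - c) := by
  obtain ⟨p, hp, rfl⟩ := hF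
  obtain ⟨q, hq, rfl⟩ := hG
  exact ⟨p - q, by rw [map_sub, hp, hq, PowerSeries.coe_sub], map_sub _ _ _⟩

theorem mul (hF : HasValueAt v a F b) (hG : HasValueAt v a G c) :
    HasValueAt v a (F * G) (b * c) := by
  obtain ⟨p, hp, rfl⟩ := hF
  obtain ⟨q, hq, rfl⟩ := hG
  exact ⟨p * q, by rw [map_mul, hp, hq, PowerSeries.coe_mul], map_mul _ _ _⟩

theorem inv (hF : HasValueAt v a F b) (hb : b ≠ 0) : HasValueAt v a F⁻¹ b⁻¹ := by
  obtain ⟨p, hp, rfl⟩ := hF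
  refine ⟨p⁻¹, ?_, PowerSeries.constantCoeff_inv p⟩
  rw [map_inv₀, hp]
  refine inv_eq_of_mul_eq_one_right ?_
  rw [← PowerSeries.coe_mul, PowerSeries.mul_inv_cancel _ hb, PowerSeries.coe_one]

theorem div (hF : HasValueAt v a F b) (hG : HasValueAt v a G c) (hc : c ≠ 0) :
    HasValueAt v a (F / G) (b / c) := by
  rw [div_eq_mul_inv, div_eq_mul_inv]
  exact hF.mul (hG.inv hc)

theorem prod {ι : Type*} (s : Finset ι) {F b : ι → K} (h : ∀ i ∈ s, HasValueAt v a (F i) (b i)) :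
    HasValueAt v a (∏ i ∈ s, F i) (∏ i ∈ s, b i) := by
  classical
  induction s using Finset.induction_on with
  | empty => simpa using of_mem (one_mem (constants v))
  | insert i s hi ih =>
    rw [Finset.prod_insert hi, Finset.prod_insert hi]
    exact (h i (Finset.mem_insert_self i s)).mul
      (ih fun j hj => h j (Finset.mem_insert_of_mem hj))

theorem residue_eq_zero (hF : HasValueAt v a F b) : residue v a F = 0 := by
  obtain ⟨p, hp, -⟩ := hF
  rw [residue_eq_coeff, hp, PowerSeries.coeff_coe, if_pos (by norm_num)]

/-- The residue at a simple pole. -/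
theorem residue_inv_mul (hF : HasValueAt v a F b) (ha : a ∈ constants v) :
    residue v a ((Z v - a)⁻¹ * F) = b := by
  obtain ⟨p, hp, rfl⟩ := hF
  have hX : expansion v a (Z v - a) = HahnSeries.single 1 1 := by
    rw [map_sub, expansion_Z, expansion_of_mem ha, ← PowerSeries.coe_sub, add_sub_cancel_right,
      PowerSeries.coe_X]
  rw [residue_eq_coeff, map_mul, map_inv₀, hX, hp, HahnSeries.inv_single, inv_one]
  have h := HahnSeries.coeff_single_mul_add (Γ := ℤ) (r := (1 : K)) (x := (p : LaurentSeries K))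
    (a := 0) (b := -1)
  rw [zero_add] at h
  rw [h, one_mul, PowerSeries.coeff_coe]
  simp

end HasValueAt

theorem residue_const_mul {v : Vertex} {c : K} (hc : c ∈ constants v) (a F : K) :
    residue v a (c * F) = c * residue v a F := by
  rw [residue_eq_coeff, residue_eq_coeff, map_mul, expansion_of_mem hc, PowerSeries.coe_C,
    HahnSeries.C_mul_eq_smul, HahnSeries.coeff_smul, smul_eq_mul]

theorem residue_sum {ι : Type*} (v : Vertex) (a : K) (s : Finset ι) (F : ι → K) :
    residue v a (∑ i ∈ s, F i) = ∑ i ∈ s, residue v a (F i) := by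
  simp only [residue_eq_coeff, map_sum, HahnSeries.coeff_sum]

theorem ratCast_mem_constants (v : Vertex) (q : ℚ) : (q : K) ∈ constants v :=
  SubfieldClass.ratCast_mem _ q

/-! ### Values of e_k at the residue points. -/

theorem coeff_L0 (k d : ℕ) : PowerSeries.coeff d (L0 k) = ((k * d)! : ℚ) / ((d ! : ℚ) ^ k) :=
  PowerSeries.coeff_mk _ _

theorem coeff_L0_ne_zero (k d : ℕ) : PowerSeries.coeff d (L0 k) ≠ 0 := by
  rw [coeff_L0]; positivity

/-- The j-th factor equals (k(m+1) - j)/(m+1), so the numerators form the quotient (k(m+1))!/(km)!.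
-/
theorem coeff_L0_succ_div (k m : ℕ) :
    ∏ j ∈ Finset.range k, ((j : ℚ) * (m / (m + 1)) + (k - j))
      = PowerSeries.coeff (m + 1) (L0 k) / PowerSeries.coeff m (L0 k) := by
  have h1 : ∏ j ∈ Finset.range k, ((j : ℚ) * (m / (m + 1)) + (k - j))
      = ((k * (m + 1)).descFactorial k : ℚ) / (m + 1) ^ k := by
    rw [Nat.descFactorial_eq_prod_range, Nat.cast_prod, Finset.pow_eq_prod_const,
      ← Finset.prod_div_distrib]
    refine Finset.prod_congr rfl fun j hj => ?_
    rw [Finset.mem_range] at hj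
    rw [Nat.cast_sub (hj.le.trans (Nat.le_mul_of_pos_right _ (Nat.succ_pos _)))]
    push_cast
    field_simp
    ring
  have h2 : ((k * m)! : ℚ) * ((k * (m + 1)).descFactorial k : ℚ) = ((k * (m + 1))! : ℚ) := by
    have := Nat.factorial_mul_descFactorial (n := k * (m + 1)) (k := k)
      (Nat.le_mul_of_pos_right _ (Nat.succ_pos _))
    rw [show k * (m + 1) - k = k * m by rw [mul_add, mul_one, Nat.add_sub_cancel]] at this
    exact_mod_cast this
  rw [h1, coeff_L0, coeff_L0, ← h2, Nat.factorial_succ]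
  push_cast
  rw [mul_pow]
  field_simp

/-- `e_k(x, y)` without its factor `k x`. -/
def reducedE (k : ℕ) (x y : K) : K :=
  ∏ j ∈ Finset.range k, ((j : K) * x + ((k : K) - (j : K)) * y)

/-- The factor split off is the one with j = k; it cancels k z_{i,j} in the denominator of the
integrand. -/
theorem e_eq (k : ℕ) (x y : K) : e k x y = (k * x) * reducedE k x y := by
  rw [e, Finset.prod_range_succ, reducedE]
  ring

theorem reducedE_point (k m : ℕ) (y : K) :
    reducedE k ((m : K) / ((m : K) + 1) * y) y
      = ((PowerSeries.coeff (m + 1) (L0 k) / PowerSeries.coeff m (L0 k) : ℚ) : K) * y ^ k := by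
  rw [← coeff_L0_succ_div, Rat.cast_prod, reducedE, Finset.pow_eq_prod_const,
    ← Finset.prod_mul_distrib]
  refine Finset.prod_congr rfl fun j _ => ?_
  push_cast
  ring

theorem reducedE_zero (k : ℕ) (y : K) : 
    reducedE k 0 y = (PowerSeries.coeff 1 (L0 k) : ℚ) * y ^ k := by
  have := reducedE_point k 0 y
  simpa [coeff_L0] using this

theorem HasValueAt.reducedE {v : Vertex} {a x y b c : K} (k : ℕ) (hx : HasValueAt v a x b)
    (hy : HasValueAt v a y c) : HasValueAt v a (reducedE k x y) (reducedE k b c) :=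
  .prod _ fun j _ => ((of_mem (natCast_mem _ j)).mul hx).add
    ((of_mem (sub_mem (natCast_mem _ k) (natCast_mem _ j))).mul hy)

theorem reducedE_mem_constants {v : Vertex} {x y : K} (k : ℕ) (hx : x ∈ constants v)
    (hy : y ∈ constants v) : reducedE k x y ∈ constants v :=
  prod_mem fun j _ => add_mem (mul_mem (natCast_mem _ j) hx)
    (mul_mem (sub_mem (natCast_mem _ k) (natCast_mem _ j)) hy)

theorem e_mem_constants {v : Vertex} {x y : K} (k : ℕ) (hx : x ∈ constants v)
    (hy : y ∈ constants v) : e k x y ∈ constants v := by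
  rw [e_eq]
  exact mul_mem (mul_mem (natCast_mem _ k) hx) (reducedE_mem_constants k hx hy)

/-! ### The chain of edges of one tail. -/

theorem z_zero (i : ℕ) : z i 0 = Z none := if_pos rfl

theorem z_of_pos (i : ℕ) {j : ℕ} (hj : 1 ≤ j) : z i j = Z (some (i, j)) :=
  if_neg (Nat.one_le_iff_ne_zero.mp hj)

theorem z_mem_constants {v : Vertex} {i j : ℕ} (hj : 1 ≤ j) (h : v ≠ some (i, j)) :
    z i j ∈ constants v := by
  rw [z_of_pos i hj]
  exact Z_mem_constants h.symm

theorem z_ne_zero (i : ℕ) {j : ℕ} (hj : 1 ≤ j) : z i j ≠ 0 := by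
  rw [z_of_pos i hj]
  exact Z_ne_zero _

/-- The factor of the `j`-th vertex of the `i`-th tail, together with the power of `z_{i,j+1}` in
the denominator, where `w` stands in for `z_{i,j-1}`. -/
def edge (k i j : ℕ) (w : K) : K :=
  e k (z i j) (z i (j + 1)) / ((2 * z i j - w - z i (j + 1)) * ((k : K) * z i j))
    * (1 / z i (j + 1) ^ k)

/-- The product of the factors of the vertices `j, …, j + r - 1` of the `i`-th tail, where `w`
stands in for `z_{i,j-1}`. -/
def chain (k i : ℕ) : ℕ → K → ℕ → K
  | _, _, 0 => 1
  | j, w, r + 1 => edge k i j w * chain k i (j + 1) (z i j) r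

theorem chain_eq_prod (k i j r : ℕ) :
    chain k i (j + 1) (z i j) r = ∏ t ∈ Finset.range r, edge k i (j + t + 1) (z i (j + t)) := by
  induction r generalizing j with
  | zero => rfl
  | succ r ih =>
    rw [chain, ih, Finset.prod_range_succ', mul_comm]
    congr 1
    refine Finset.prod_congr rfl fun t _ => ?_
    rw [show j + 1 + t = j + (t + 1) by ring]

theorem edge_mem_constants {v : Vertex} {k i j : ℕ} {w : K} (hj : 1 ≤ j)
    (h : ∀ t, j ≤ t → v ≠ some (i, t)) (hw : w ∈ constants v) : edge k i j w ∈ constants v := by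
  have h1 := z_mem_constants hj (h j le_rfl)
  have h2 := z_mem_constants (j := j + 1) (by omega) (h (j + 1) (by omega))
  exact mul_mem (div_mem (e_mem_constants k h1 h2) (mul_mem (sub_mem (sub_mem
    (mul_mem (ofNat_mem _ 2) h1) hw) h2) (mul_mem (natCast_mem _ k) h1)))
    (div_mem (one_mem _) (pow_mem h2 k))

theorem chain_mem_constants {v : Vertex} {k i j : ℕ} {w : K} (r : ℕ) (hj : 1 ≤ j)
    (h : ∀ t, j ≤ t → v ≠ some (i, t)) (hw : w ∈ constants v) : chain k i j w r ∈ constants v := by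
  induction r generalizing j w with
  | zero => exact one_mem _
  | succ r ih =>
    exact mul_mem (edge_mem_constants hj h hw) (ih (by omega) (fun t ht => h t (by omega))
      (z_mem_constants hj (h j le_rfl)))

/-- The variable of v enters only through the first denominator. At a this stays nonzero, since
otherwise z_{i,j+1} = 2 z_{i,j} - a would not involve z_{i,j+1}. -/
theorem HasValueAt.chain {v : Vertex} {k i j : ℕ} {a : K} (r : ℕ) (hk : k ≠ 0) (hj : 1 ≤ j)
    (h : ∀ t, j ≤ t → v ≠ some (i, t)) (ha : a ∈ constants (some (i, j + 1))) :
    HasValueAt v a (chain k i j (Z v) r) (chain k i j a r) := by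
  cases r with
  | zero => exact of_mem (one_mem _)
  | succ r =>
    have h1 := z_mem_constants hj (h j le_rfl)
    have h2 := z_mem_constants (j := j + 1) (by omega) (h (j + 1) (by omega))
    refine HasValueAt.mul (.mul (.div (of_mem (e_mem_constants k h1 h2)) (.mul
      (.sub (.sub (of_mem (mul_mem (ofNat_mem _ 2) h1)) (var v a)) (of_mem h2))
      (of_mem (mul_mem (natCast_mem _ k) h1))) (mul_ne_zero ?_ ?_))
      (of_mem (div_mem (one_mem _) (pow_mem h2 k))))
      (of_mem (chain_mem_constants r (by omega) (fun t ht => h t (by omega)) h1))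
    · rw [sub_ne_zero, z_of_pos i (j := j + 1) (by omega)]
      exact (Z_ne_of_mem (sub_mem (mul_mem (ofNat_mem _ 2)
        (z_mem_constants hj (by simp))) ha)).symm
    · exact mul_ne_zero (Nat.cast_ne_zero.mpr hk) (z_ne_zero i hj)

/-! ### One residue along a tail. -/

/-- The quotient `z_{i,j} / z_{i,j+1}` at the points where the residues in `z_{i,j}` are taken. -/
def ratio (m : ℕ) : K := (m : K) / ((m : K) + 1)

theorem ratio_zero : ratio 0 = 0 := by rw [ratio, Nat.cast_zero, zero_div]

theorem ratio_succ_ne_zero (m : ℕ) : ratio (m + 1) ≠ 0 :=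
  div_ne_zero (Nat.cast_ne_zero.mpr (Nat.succ_ne_zero m)) (Nat.cast_add_one_ne_zero _)

theorem ratio_injective : Function.Injective ratio := by
  intro m n h
  rw [ratio, ratio, div_eq_div_iff (Nat.cast_add_one_ne_zero m) (Nat.cast_add_one_ne_zero n)] at h
  exact Nat.cast_injective (R := K) (by linear_combination h)

theorem ratio_mem_constants (v : Vertex) (m : ℕ) : ratio m ∈ constants v :=
  div_mem (natCast_mem _ m) (add_mem (natCast_mem _ m) (one_mem _))

/-- This identity moves the zero of 2 z_{i,j} - z_{i,j-1} - z_{i,j+1} from index m to index m + 1.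
-/
theorem two_sub_ratio (m : ℕ) : 2 - ratio m = (ratio (m + 1))⁻¹ := by
  have h1 : (m : K) + 1 ≠ 0 := Nat.cast_add_one_ne_zero m
  rw [ratio, ratio, inv_div, Nat.cast_succ, eq_div_iff h1, sub_mul, div_mul_cancel₀ _ h1]
  ring

theorem inv_neg_mul_mul_cancel {F : Type*} [Field F] {a : F} (ha : a ≠ 0) (b c d : F) :
    (-(a * b))⁻¹ * (a * c * d) = -c * (b⁻¹ * d) := by
  rw [inv_neg, mul_inv, neg_mul, mul_assoc a, mul_mul_mul_comm, inv_mul_cancel₀ ha]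
  ring

/-- Displays the two simple poles in z_{i,j}, at 0 and at ratio m + 1; the remaining factor is
regular at every residue point. -/
theorem inv_mul_chain (k i j m r : ℕ) (hk : k ≠ 0) (hj : 1 ≤ j) :
    (z i j)⁻¹ * chain k i j (ratio m * z i j) (r + 1)
      = (z i j)⁻¹ * ((z i j - ratio (m + 1) * z i (j + 1))⁻¹
        * (ratio (m + 1) * reducedE k (z i j) (z i (j + 1)) * (1 / z i (j + 1) ^ k)
          * chain k i (j + 1) (z i j) r)) := by
  have h1 : (k : K) * z i j ≠ 0 := mul_ne_zero (Nat.cast_ne_zero.mpr hk) (z_ne_zero i hj)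
  have h2 := ratio_succ_ne_zero m
  have h3 : 2 * z i j - ratio m * z i j - z i (j + 1)
      = (ratio (m + 1))⁻¹ * (z i j - ratio (m + 1) * z i (j + 1)) := by
    rw [mul_sub, inv_mul_cancel_left₀ h2, ← two_sub_ratio]
    ring
  rw [chain, edge, e_eq, h3, mul_comm (_ * (_ - _)) ((k : K) * z i j), mul_div_mul_left _ _ h1,
    div_eq_mul_inv (reducedE _ _ _), mul_inv, inv_inv]
  ring

/-- The factor by which the residue at `z_{i,j} = (n / (n + 1)) z_{i,j+1}` changes the coefficient
of the term with `z_{i,j-1} = (m / (m + 1)) z_{i,j}`. -/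
def transfer (k m n : ℕ) : ℚ :=
  if n = 0 then -PowerSeries.coeff 1 (L0 k)
  else if n = m + 1 then PowerSeries.coeff (m + 2) (L0 k) / PowerSeries.coeff (m + 1) (L0 k)
  else 0

theorem residue_inv_mul_chain (k i j m n r : ℕ) (hk : k ≠ 0) (hj : 1 ≤ j) :
    residue (some (i, j)) (ratio n * z i (j + 1))
        ((z i j)⁻¹ * chain k i j (ratio m * z i j) (r + 1))
      = (transfer k m n : K)
        * ((z i (j + 1))⁻¹ * chain k i (j + 1) (ratio n * z i (j + 1)) r) := by
  rw [inv_mul_chain k i j m r hk hj]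
  have hx : z i j = Z (some (i, j)) := z_of_pos i hj
  have hy : z i (j + 1) ∈ constants (some (i, j)) := z_mem_constants (by omega) (by simp)
  have hy' : z i (j + 1) ∈ constants (some (i, j + 1 + 1)) := z_mem_constants (by omega) (by simp)
  have hy0 : z i (j + 1) ≠ 0 := z_ne_zero i (by omega)
  have ha : ∀ n, ratio n * z i (j + 1) ∈ constants (some (i, j)) :=
    fun n => mul_mem (ratio_mem_constants _ n) hy
  have hE : ∀ n, reducedE k (ratio n * z i (j + 1)) (z i (j + 1)) * (1 / z i (j + 1) ^ k)
      = ((PowerSeries.coeff (n + 1) (L0 k) / PowerSeries.coeff n (L0 k) : ℚ) : K) := by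
    intro n
    rw [ratio, reducedE_point, mul_assoc, mul_one_div_cancel (pow_ne_zero k hy0), mul_one]
  have hG : ∀ n, HasValueAt (some (i, j)) (ratio n * z i (j + 1))
      (ratio (m + 1) * reducedE k (z i j) (z i (j + 1)) * (1 / z i (j + 1) ^ k)
          * chain k i (j + 1) (z i j) r)
      (ratio (m + 1)
          * ((PowerSeries.coeff (n + 1) (L0 k) / PowerSeries.coeff n (L0 k) : ℚ) : K)
          * chain k i (j + 1) (ratio n * z i (j + 1)) r) := by
    intro n
    rw [hx, ← hE, ← mul_assoc (ratio (m + 1))]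
    exact .mul (.mul (.mul (.of_mem (ratio_mem_constants _ _)) (.reducedE k (.var _ _) (.of_mem hy)))
      (.of_mem (div_mem (one_mem _) (pow_mem hy k))))
      (.chain r hk (by omega) (fun t ht => by simp; omega)
        (mul_mem (ratio_mem_constants _ n) hy'))
  have hX : HasValueAt (some (i, j)) (ratio n * z i (j + 1)) (z i j) (ratio n * z i (j + 1)) := by
    rw [hx]
    exact .var _ _
  have h1 := ratio_succ_ne_zero m
  by_cases hn : n = 0
  · subst hn
    -- Pole at 0: the other pole factor contributes -(ratio (m + 1) · z_{i,j+1})⁻¹, whence the minus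
    -- sign.
    have h := ((hX.sub (.of_mem (ha (m + 1)))).inv (by
      rw [ratio_zero, zero_mul, zero_sub]
      exact neg_ne_zero.mpr (mul_ne_zero h1 hy0))).mul (hG 0)
    have h' := h.residue_inv_mul (ha 0)
    rw [← hx] at h'
    rw [ratio_zero, zero_mul, sub_zero, zero_sub] at h'
    rw [ratio_zero, zero_mul, h', transfer, if_pos rfl]
    have h0 : PowerSeries.coeff 0 (L0 k) = 1 := by simp [coeff_L0]
    rw [zero_add, h0, div_one, Rat.cast_neg]
    exact inv_neg_mul_mul_cancel h1 _ _ _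
  · by_cases hnm : n = m + 1
    · subst hnm
      -- Pole at ratio m + 1: here z_{i,j}⁻¹ is the regular factor, and its ratio cancels.
      have h := (hX.inv (mul_ne_zero h1 hy0)).mul (hG (m + 1))
      have h' := h.residue_inv_mul (ha (m + 1))
      rw [← hx] at h'
      rw [mul_left_comm, h', transfer, if_neg hn, if_pos rfl, mul_inv,
        mul_assoc (ratio (m + 1)), mul_mul_mul_comm, inv_mul_cancel₀ h1]
      ring
    · have h2 : ratio n ≠ 0 := by
        rw [← ratio_zero]
        exact ratio_injective.ne hn
      have h := (hX.inv (mul_ne_zero h2 hy0)).mul (((hX.sub (.of_mem (ha (m + 1)))).inv (by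
        rw [← sub_mul]
        exact mul_ne_zero (sub_ne_zero.mpr (ratio_injective.ne hnm)) hy0)).mul (hG n))
      rw [h.residue_eq_zero, transfer, if_neg hn, if_neg hnm, Rat.cast_zero, zero_mul]

/-! ### The recursion along a tail and its solution. -/

theorem constantCoeff_L0 (k : ℕ) : PowerSeries.constantCoeff (L0 k) = 1 := by
  rw [← PowerSeries.coeff_zero_eq_constantCoeff_apply, coeff_L0]
  simp

/-- The coefficient of q^{t+1} in L̃_0 · L̃_0⁻¹ = 1, with the constant term of L̃_0 split off. -/
theorem sum_coeff_inv_L0_mul (k t : ℕ) :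
    ∑ m ∈ Finset.range (t + 1),
        PowerSeries.coeff (t - m) (L0 k)⁻¹ * PowerSeries.coeff (m + 1) (L0 k)
      = -PowerSeries.coeff (t + 1) (L0 k)⁻¹ := by
  have h := congrArg (PowerSeries.coeff (t + 1)) (PowerSeries.mul_inv_cancel (L0 k)
    (by rw [constantCoeff_L0]; exact one_ne_zero))
  rw [PowerSeries.coeff_mul, Finset.Nat.sum_antidiagonal_eq_sum_range_succ_mk,
    Finset.sum_range_succ', PowerSeries.coeff_one, if_neg (Nat.succ_ne_zero t)] at h
  simp only [PowerSeries.coeff_zero_eq_constantCoeff_apply, constantCoeff_L0, one_mul,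
    Nat.sub_zero] at h
  rw [eq_neg_iff_add_eq_zero, ← h]
  congr 1
  refine Finset.sum_congr rfl fun m _ => ?_
  rw [Nat.add_sub_add_right, mul_comm]

/-- The coefficients of the terms left over after the residues in the first `t` variables of a
tail. -/
def chainCoeff (k t m : ℕ) : ℚ :=
  PowerSeries.coeff (t - m) (L0 k)⁻¹ * PowerSeries.coeff (m + 1) (L0 k)

/-- For n = 0 every m contributes and the convolution identity sums them; for n ≥ 1 only m = n - 1
survives and the quotient of coefficients telescopes. -/
theorem sum_chainCoeff_mul_transfer (k t n : ℕ) (hn : n ≤ t + 1) :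
    ∑ m ∈ Finset.range (t + 1), chainCoeff k t m * transfer k m n = chainCoeff k (t + 1) n := by
  rcases n with _ | n
  · simp only [transfer, if_true]
    rw [← Finset.sum_mul]
    simp only [chainCoeff]
    rw [sum_coeff_inv_L0_mul]
    simp
  · rw [Finset.sum_eq_single n]
    · rw [transfer, if_neg n.succ_ne_zero, if_pos rfl, chainCoeff, chainCoeff,
        Nat.add_sub_add_right, mul_assoc, mul_div_cancel₀ _ (coeff_L0_ne_zero k _)]
    · intro m _ hm
      rw [transfer, if_neg n.succ_ne_zero, if_neg (by omega), mul_zero]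
    · intro h
      exact absurd (Finset.mem_range.mpr (by omega)) h

/-- The number r of untouched edges is left free because each induction step consumes one edge. -/
theorem innerResidue_chain (k i t r : ℕ) (hk : k ≠ 0) :
    innerResidue i t ((PowerSeries.coeff 1 (L0 k) : ℚ) * ((z i 1)⁻¹ * chain k i 1 0 (t + r)))
      = ∑ m ∈ Finset.range (t + 1), (chainCoeff k t m : K)
        * ((z i (t + 1))⁻¹ * chain k i (t + 1) (ratio m * z i (t + 1)) r) := by
  induction t generalizing r with
  | zero =>
    simp [innerResidue, chainCoeff, ratio_zero, constantCoeff_L0]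
  | succ t ih =>
    rw [innerResidue, show t + 1 + r = t + (r + 1) by ring, ih]
    refine Finset.sum_congr rfl fun n hn => ?_
    have hn' : n ≤ t + 1 := by
      rw [Finset.mem_range] at hn
      omega
    rw [residue_sum, ← sum_chainCoeff_mul_transfer k t n hn', Rat.cast_sum, Finset.sum_mul]
    refine Finset.sum_congr rfl fun m _ => ?_
    rw [residue_const_mul (ratCast_mem_constants _ _), ← ratio,
      residue_inv_mul_chain k i (t + 1) m n r hk (by omega), Rat.cast_mul, mul_assoc]

/-- Once the chain is used up only multiples of z_{i,n}⁻¹ remain, so the last residue adds up their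
coefficients. -/
theorem tailResidue_chain (k i n : ℕ) (hk : k ≠ 0) (hn : 1 ≤ n) :
    tailResidue i n ((PowerSeries.coeff 1 (L0 k) : ℚ) * ((z i 1)⁻¹ * chain k i 1 0 (n - 1)))
      = ((-PowerSeries.coeff n (L0 k)⁻¹ : ℚ) : K) := by
  obtain ⟨t, rfl⟩ : ∃ t, n = t + 1 := ⟨n - 1, by omega⟩
  have h := innerResidue_chain k i t 0 hk
  rw [add_zero] at h
  rw [tailResidue, Nat.add_sub_cancel, h, residue_sum, ← sum_coeff_inv_L0_mul, Rat.cast_sum]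
  refine Finset.sum_congr rfl fun m _ => ?_
  have h1 := (HasValueAt.of_mem (v := some (i, t + 1)) (a := 0) (one_mem _)).residue_inv_mul
    (zero_mem _)
  rw [sub_zero] at h1
  rw [residue_const_mul (ratCast_mem_constants _ _), chain, z_of_pos i (by omega), h1, mul_one,
    chainCoeff]

/-! ### Decoupling of the tails. -/

theorem innerResidue_const_mul {i : ℕ} {c : K} (hc : ∀ j, c ∈ constants (some (i, j))) (n : ℕ)
    (F : K) : innerResidue i n (c * F) = c * innerResidue i n F := by
  induction n with
  | zero => rfl
  | succ n ih =>
    rw [innerResidue, innerResidue, Finset.mul_sum, ih]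
    exact Finset.sum_congr rfl fun m _ => residue_const_mul (hc _) _ _

theorem tailResidue_const_mul {i : ℕ} {c : K} (hc : ∀ j, c ∈ constants (some (i, j))) (n : ℕ)
    (F : K) : tailResidue i n (c * F) = c * tailResidue i n F := by
  rw [tailResidue, tailResidue, innerResidue_const_mul hc, residue_const_mul (hc n)]

/-- The factors of the integrand that belong to the `i`-th tail, of length `d`, without the factor
`k z_0` of `e_k(z_0, z_{i,1})`, where `w` stands in for `z_0`. -/
def tailFactor (k i d : ℕ) (w : K) : K :=
  reducedE k w (z i 1) / (z i 1 - w) * (1 / z i 1 ^ k) * chain k i 1 w (d - 1)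

theorem tailFactor_zero (k i d : ℕ) :
    tailFactor k i d 0
      = (PowerSeries.coeff 1 (L0 k) : ℚ) * ((z i 1)⁻¹ * chain k i 1 0 (d - 1)) := by
  have h : z i 1 ^ k ≠ 0 := pow_ne_zero k (z_ne_zero i le_rfl)
  rw [tailFactor, reducedE_zero, sub_zero, div_mul_div_comm, mul_one, mul_div_mul_right _ _ h,
    div_eq_mul_inv, mul_assoc]

theorem HasValueAt.tailFactor (k i d : ℕ) (hk : k ≠ 0) :
    HasValueAt none 0 (tailFactor k i d (Z none)) (tailFactor k i d 0) := by
  have h : z i 1 ∈ constants none := z_mem_constants le_rfl (by simp)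
  refine .mul (.mul (.div (.reducedE k (.var _ _) (.of_mem h)) (.sub (.of_mem h) (.var _ _)) ?_)
    (.of_mem (div_mem (one_mem _) (pow_mem h k))))
    (.chain _ hk le_rfl (fun t _ => by simp) (zero_mem _))
  rw [sub_zero]
  exact z_ne_zero i le_rfl

theorem tailFactor_zero_mem_constants {v : Vertex} (k i d : ℕ) (h : ∀ j, v ≠ some (i, j)) :
    tailFactor k i d 0 ∈ constants v := by
  rw [tailFactor_zero]
  exact mul_mem (ratCast_mem_constants _ _) (mul_mem (inv_mem (z_mem_constants le_rfl (h 1)))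
    (chain_mem_constants _ le_rfl (fun t _ => h t) (zero_mem _)))

/-- After z_0 is set to 0, the tails not yet treated are constants for the residues of the current
one. -/
theorem iteratedResidue_mul_prod_tailFactor (k : ℕ) (hk : k ≠ 0) (D : ℕ → ℕ) (A : ℚ) (l n : ℕ)
    (hD : ∀ i < l, 1 ≤ D i) (hn : n ≤ l) :
    iteratedResidue D n
        ((A : K) * ((Z none)⁻¹ * ∏ i ∈ Finset.range l, tailFactor k i (D i) (Z none)))
      = ((A * ∏ i ∈ Finset.range n, -PowerSeries.coeff (D i) (L0 k)⁻¹ : ℚ) : K)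
        * ∏ i ∈ Finset.Ico n l, tailFactor k i (D i) 0 := by
  induction n with
  | zero =>
    have h := (HasValueAt.prod (v := none) (a := 0) (Finset.range l)
      (fun i _ => HasValueAt.tailFactor k i (D i) hk)).residue_inv_mul (zero_mem _)
    rw [sub_zero] at h
    rw [iteratedResidue, residue_const_mul (ratCast_mem_constants _ _), h, Finset.range_zero,
      Finset.prod_empty, mul_one, Finset.range_eq_Ico]
  | succ n ih =>
    rw [iteratedResidue, ih (by omega), Finset.prod_eq_prod_Ico_succ_bot (by omega : n < l),
      mul_comm (tailFactor k n (D n) 0), ← mul_assoc, tailResidue_const_mul,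
      tailFactor_zero, tailResidue_chain k n (D n) hk (hD n (by omega)),
      Finset.prod_range_succ, ← mul_assoc A]
    · rw [mul_right_comm, ← Rat.cast_mul]
    · intro j
      refine mul_mem (ratCast_mem_constants _ _) (prod_mem fun i hi => ?_)
      rw [Finset.mem_Ico] at hi
      refine tailFactor_zero_mem_constants k i (D i) fun t h => ?_
      simp only [Option.some.injEq, Prod.mk.injEq] at h
      omega

/-! ### Factorisation of the integrand. -/

theorem prod_tail (k i d : ℕ) (hd : 1 ≤ d) :
    e k (Z none) (z i 1) / (z i 1 - Z none)
      * (∏ j ∈ Finset.Icc 1 (d - 1), e k (z i j) (z i (j + 1)) /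
          ((2 * z i j - z i (j - 1) - z i (j + 1)) * ((k : K) * z i j)))
      * (∏ j ∈ Finset.Icc 1 d, 1 / z i j ^ k)
      = (k * Z none) * tailFactor k i d (Z none) := by
  obtain ⟨t, rfl⟩ : ∃ t, d = t + 1 := ⟨d - 1, by omega⟩
  have hIcc : ∀ (f : ℕ → K) (n : ℕ), ∏ j ∈ Finset.Icc 1 n, f j = ∏ j ∈ Finset.range n, f (j + 1) := by
    intro f n
    rw [Finset.range_eq_Ico, Finset.prod_Ico_add' f 0 n 1]
    rfl
  have hc := chain_eq_prod k i 0 t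
  rw [z_zero, zero_add] at hc
  rw [tailFactor, Nat.add_sub_cancel, hc, hIcc, hIcc, Finset.prod_range_succ' _ t]
  simp only [edge, zero_add, Nat.add_sub_cancel]
  rw [Finset.prod_mul_distrib, e_eq]
  ring

theorem part_pos {d : ℕ} (σ : d.Partition) {i : ℕ} (hi : i < len σ) : 1 ≤ part σ i := by
  rw [part, List.getD_eq_getElem _ _ hi]
  refine σ.parts_pos ?_
  rw [← Multiset.mem_sort (r := (· ≥ ·))]
  exact List.getElem_mem hi

theorem len_eq_card {d : ℕ} (σ : d.Partition) : len σ = σ.parts.card :=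
  Multiset.length_sort _

theorem len_pos {d : ℕ} (hd : 1 ≤ d) (σ : d.Partition) : 1 ≤ len σ := by
  rw [len_eq_card, Nat.one_le_iff_ne_zero, Ne, Multiset.card_eq_zero]
  intro h
  have := σ.parts_sum
  rw [h, Multiset.sum_zero] at this
  omega

theorem prod_part {d : ℕ} (σ : d.Partition) (f : ℕ → ℚ) :
    ∏ i ∈ Finset.range (len σ), f (part σ i) = (σ.parts.map f).prod := by
  conv_rhs => rw [← Multiset.sort_eq σ.parts (· ≥ ·), Multiset.map_coe, Multiset.prod_coe]
  rw [Finset.prod_range, ← List.prod_ofFn]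
  congr 1
  refine List.ext_getElem (by simp [len, partsList]) fun i h1 h2 => ?_
  rw [List.length_ofFn] at h1
  rw [List.getElem_ofFn, part, List.getD_eq_getElem _ _ h1, List.getElem_map]
  rfl

theorem eulerNumber_eq (k : ℕ) : eulerNumber k k = k * topChernCoeff k k := by
  rw [eulerNumber, hypersurfaceIntegral, PowerSeries.coeff_monomial_same]

/-- The exponent of x is (k - 2) - (l - 1) + l - k = -1: the degree equals the number of homogeneous
coordinates, so the central pole is simple. -/
theorem center_factor {F : Type*} [Field F] {k l : ℕ} (hk : 2 ≤ k) (hl : 1 ≤ l) {x κ : F}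
    (hx : x ≠ 0) (hκ : κ ≠ 0) (c : F) :
    c * x ^ (k - 2) / (κ * x) ^ (l - 1) * (κ * x) ^ l * (1 / x ^ k) = κ * c * x⁻¹ := by
  obtain ⟨m, rfl⟩ : ∃ m, k = m + 2 := ⟨k - 2, by omega⟩
  obtain ⟨n, rfl⟩ : ∃ n, l = n + 1 := ⟨l - 1, by omega⟩
  rw [Nat.add_sub_cancel, Nat.add_sub_cancel]
  field_simp
  ring

theorem integrand_eq (k : ℕ) (hk : 2 ≤ k) {d : ℕ} (hd : 1 ≤ d) (σ : d.Partition) :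
    integrand k k σ = ((symFactor σ * (eulerNumber k k / 24) : ℚ) : K)
      * ((Z none)⁻¹ * ∏ i ∈ Finset.range (len σ), tailFactor k i (part σ i) (Z none)) := by
  have h := Finset.prod_congr (rfl : Finset.range (len σ) = _) fun i hi =>
    prod_tail k i (part σ i) (part_pos σ (Finset.mem_range.mp hi))
  rw [Finset.prod_mul_distrib, Finset.prod_mul_distrib, Finset.prod_mul_distrib,
    Finset.prod_const, Finset.card_range] at h
  have hc := center_factor hk (len_pos hd σ) (Z_ne_zero none)
    (κ := (k : K)) (Nat.cast_ne_zero.mpr (by omega)) (topChernCoeff k k : K)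
  rw [eulerNumber_eq, integrand, cT]
  push_cast
  generalize (topChernCoeff k k : K) * Z none ^ (k - 2) / ((k : K) * Z none) ^ (len σ - 1) = a at *
  generalize (k : K) * (topChernCoeff k k : K) = b at *
  generalize ∏ i ∈ Finset.range (len σ), tailFactor k i (part σ i) (Z none) = t at *
  linear_combination (symFactor σ : K) * (1 / 24) * a * (1 / Z none ^ k) * h
    + (symFactor σ : K) * (1 / 24) * t * hc

theorem starResidue_eq (k : ℕ) (hk : 2 ≤ k) {d : ℕ} (hd : 1 ≤ d) (σ : d.Partition) :
    starResidue k k σ = ((symFactor σ * (eulerNumber k k / 24)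
      * (σ.parts.map fun j => -PowerSeries.coeff j (L0 k)⁻¹).prod : ℚ) : K) := by
  rw [starResidue, integrand_eq k hk hd, iteratedResidue_mul_prod_tailFactor k (by omega) _ _ _ _
    (fun i hi => part_pos σ hi) le_rfl, Finset.Ico_self, Finset.prod_empty, mul_one,
    ← prod_part σ fun j => -PowerSeries.coeff j (L0 k)⁻¹]

end StarGraph

/-! ### Logarithms and powers of power series. -/

namespace PowerSeries

theorem derivative_logOf {g : PowerSeries ℚ} (hg : constantCoeff g = 1) :
    derivative ℚ (logOf g) = g⁻¹ * derivative ℚ g := by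
  have hs : HasSubst (g - 1) := HasSubst.of_constantCoeff_zero' (by simp [hg])
  have h1 : derivative ℚ (log ℚ) * (1 + X) = 1 := by
    rw [deriv_log]
    ext n
    rw [mul_add, mul_one, map_add]
    cases n with
    | zero => simp
    | succ n => simp [coeff_succ_mul_X, coeff_one, pow_succ]
  have h2 := congrArg (subst (g - 1)) h1
  rw [subst_mul hs, subst_add hs, subst_X hs, ← coe_substAlgHom hs, map_one,
    add_sub_cancel] at h2
  have h3 : derivative ℚ (1 : PowerSeries ℚ) = 0 := by simp
  rw [logOf_eq, derivative_subst hs, map_sub, h3, sub_zero, ← coe_substAlgHom hs,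
    (eq_inv_iff_mul_eq_one (by rw [hg]; exact one_ne_zero)).mpr h2]

theorem logOf_inv {f : PowerSeries ℚ} (hf : constantCoeff f = 1) : logOf f⁻¹ = -logOf f := by
  have hf' : constantCoeff f⁻¹ = 1 := by rw [constantCoeff_inv, hf, inv_one]
  have h : f * f⁻¹ = 1 := PowerSeries.mul_inv_cancel f (by rw [hf]; exact one_ne_zero)
  have h' : f⁻¹⁻¹ = f :=
    (inv_eq_iff_mul_eq_one (by rw [hf']; exact one_ne_zero)).mpr h
  refine derivative.ext ?_ ?_
  · rw [map_neg, derivative_logOf hf, derivative_logOf hf', derivative_inv', h']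
    linear_combination -f⁻¹ * derivative ℚ f * h
  · rw [map_neg, constantCoeff_logOf hf, constantCoeff_logOf hf', neg_zero]

theorem coeff_pow_eq_zero {R : Type*} [CommRing R] {f : PowerSeries R} (hf : constantCoeff f = 0)
    {d n : ℕ} (h : d < n) : coeff d (f ^ n) = 0 :=
  X_pow_dvd_iff.mp (pow_dvd_pow_of_dvd (X_dvd_iff.mpr hf) n) d h

theorem coeff_logOf_one_sub {T : PowerSeries ℚ} (hT : constantCoeff T = 0) {d : ℕ} :
    coeff d (logOf (1 - T)) = -∑ n ∈ Finset.Icc 1 d, coeff d (T ^ n) / n := by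
  have hs : HasSubst (1 - T - 1) := HasSubst.of_constantCoeff_zero' (by simp [hT])
  rw [logOf_eq, coeff_subst' hs, finsum_eq_sum_of_support_subset (s := Finset.Icc 1 d),
    ← Finset.sum_neg_distrib]
  · refine Finset.sum_congr rfl fun n hn => ?_
    have hn0 : n ≠ 0 := by
      rw [Finset.mem_Icc] at hn
      omega
    rw [coeff_log, if_neg hn0, show (1 - T - 1 : PowerSeries ℚ) = C (-1) * T by simp, mul_pow,
      ← map_pow, coeff_C_mul, smul_eq_mul, pow_succ, Algebra.algebraMap_self, RingHom.id_apply]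
    have : ((-1 : ℚ) ^ n) * (-1) ^ n = 1 := by rw [← mul_pow]; simp
    linear_combination (-coeff d (T ^ n) / n) * this
  · intro n hn
    rw [Finset.coe_Icc, Set.mem_Icc]
    by_contra h
    refine hn ?_
    beta_reduce
    rcases Nat.eq_zero_or_pos n with rfl | hn0
    · simp
    · rw [coeff_pow_eq_zero (by simp [hT]) (by omega), smul_zero]

/-- Replaces f by a finite sum of monomials, to which the multinomial theorem applies. -/
theorem trunc_sum_monomial {R : Type*} [CommRing R] {f : PowerSeries R}
    (hf : constantCoeff f = 0) (d : ℕ) :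
    trunc (d + 1) (∑ j ∈ Finset.Icc 1 d, monomial j (coeff j f)) = trunc (d + 1) f := by
  ext j
  rw [coeff_trunc, coeff_trunc]
  split_ifs with hj
  · rw [map_sum]
    simp only [coeff_monomial]
    rw [Finset.sum_ite_eq]
    rcases Nat.eq_zero_or_pos j with rfl | hj0
    · simp [hf]
    · rw [if_pos (Finset.mem_Icc.mpr (by omega))]
  · rfl

theorem prod_map_monomial {R : Type*} [CommRing R] (t : ℕ → R) (m : Multiset ℕ) :
    (m.map fun j => monomial j (t j)).prod = monomial m.sum (m.map t).prod := by
  induction m using Multiset.induction_on with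
  | empty => simp
  | cons a m ih =>
    rw [Multiset.map_cons, Multiset.prod_cons, ih, Multiset.sum_cons, Multiset.map_cons,
      Multiset.prod_cons, monomial_mul_monomial]

/-- The coefficients of a power, as sums over partitions. -/
theorem coeff_pow_eq_sum_partition {R : Type*} [CommRing R] {f : PowerSeries R}
    (hf : constantCoeff f = 0) (d n : ℕ) :
    coeff d (f ^ n) = ∑ σ : d.Partition with σ.parts.card = n,
      (σ.parts.countPerms : R) * (σ.parts.map fun j => coeff j f).prod := by
  have h1 : coeff d (f ^ n)
      = coeff d ((∑ j ∈ Finset.Icc 1 d, monomial j (coeff j f)) ^ n) := by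
    have h := congrArg (Polynomial.coeff · d) (trunc_trunc_pow f (d + 1) n)
    have h' := congrArg (Polynomial.coeff · d)
      (trunc_trunc_pow (∑ j ∈ Finset.Icc 1 d, monomial j (coeff j f)) (d + 1) n)
    simp only [coeff_trunc, Nat.lt_succ_self, if_true, trunc_sum_monomial hf] at h h'
    rw [← h, ← h']
  rw [h1, Finset.sum_pow, map_sum]
  simp only [prod_map_monomial]
  have h2 : ∀ m : Sym ℕ n, coeff d (((m : Multiset ℕ).countPerms : PowerSeries R)
      * monomial (m : Multiset ℕ).sum ((m : Multiset ℕ).map fun j => coeff j f).prod)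
      = if (m : Multiset ℕ).sum = d then ((m : Multiset ℕ).countPerms : R)
        * ((m : Multiset ℕ).map fun j => coeff j f).prod else 0 := by
    intro m
    rw [← map_natCast C, coeff_C_mul, coeff_monomial]
    simp [eq_comm]
  refine (Finset.sum_congr rfl fun m _ => h2 m).trans ?_
  rw [← Finset.sum_filter]
  symm
  -- Multisets of n exponents in [1, d] with sum d are the partitions of d into n parts.
  refine Finset.sum_bij (fun σ hσ => ⟨σ.parts, (Finset.mem_filter.mp hσ).2⟩) ?_ ?_ ?_ ?_
  · intro σ hσ
    refine Finset.mem_filter.mpr ⟨Finset.mem_sym_iff.mpr fun j hj =>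
      Finset.mem_Icc.mpr ⟨σ.parts_pos hj, ?_⟩, σ.parts_sum⟩
    exact (Multiset.le_sum_of_mem hj).trans_eq σ.parts_sum
  · intro σ _ τ _ h
    exact Nat.Partition.ext (congrArg Subtype.val h)
  · intro m hm
    rw [Finset.mem_filter, Finset.mem_sym_iff] at hm
    exact ⟨⟨m.1, fun {j} hj => (Finset.mem_Icc.mp (hm.1 j hj)).1, hm.2⟩,
      Finset.mem_filter.mpr ⟨Finset.mem_univ _, m.2⟩, rfl⟩
  · intro σ _
    rfl

end PowerSeries

/-! ### Symmetry factors and the sum over partitions. -/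

namespace StarGraph

theorem symFactor_eq {d : ℕ} (hd : 1 ≤ d) (σ : d.Partition) :
    symFactor σ = (σ.parts.countPerms : ℚ) / σ.parts.card := by
  have hsub : σ.parts.toFinsupp.support ⊆ Finset.Icc 1 d := by
    intro j hj
    rw [Multiset.toFinsupp_support, Multiset.mem_toFinset] at hj
    exact Finset.mem_Icc.mpr ⟨σ.parts_pos hj, (Multiset.le_sum_of_mem hj).trans_eq σ.parts_sum⟩
  have h := Nat.multinomial_spec (Finset.Icc 1 d) σ.parts.toFinsupp
  rw [← Finsupp.multinomial_eq_of_support_subset hsub] at h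
  have hsum : ∑ i ∈ Finset.Icc 1 d, σ.parts.toFinsupp i = σ.parts.card := by
    rw [← Multiset.toFinsupp_sum_eq, Finsupp.sum_of_support_subset _ hsub _ (by simp)]
    rfl
  rw [hsum] at h
  have hl : 1 ≤ σ.parts.card := len_eq_card σ ▸ len_pos hd σ
  have h' : (∏ j ∈ Finset.Icc 1 d, ((σ.parts.count j)! : ℚ)) * σ.parts.countPerms
      = σ.parts.card * ((σ.parts.card - 1)! : ℚ) := by
    rw [← Nat.cast_mul (σ.parts.card), Nat.mul_factorial_pred (by omega), ← h]
    push_cast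
    rfl
  rw [symFactor, len_eq_card, div_eq_div_iff (Finset.prod_ne_zero_iff.mpr fun j _ => by positivity)
    (by positivity)]
  linear_combination -h'

/-- Partitions are grouped by length n: the orderings assemble T^n, and the remaining 1/n is the
coefficient of the logarithm. -/
theorem sum_symFactor_mul {T : PowerSeries ℚ} (hT : PowerSeries.constantCoeff T = 0) {d : ℕ}
    (hd : 1 ≤ d) :
    ∑ σ : d.Partition, symFactor σ * (σ.parts.map fun j => PowerSeries.coeff j T).prod
      = -PowerSeries.coeff d (PowerSeries.logOf (1 - T)) := by
  rw [PowerSeries.coeff_logOf_one_sub hT, neg_neg, ← Finset.sum_fiberwise_of_maps_to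
    (s := Finset.univ) (t := Finset.Icc 1 d) (g := fun σ : d.Partition => σ.parts.card)]
  · refine Finset.sum_congr rfl fun n _ => ?_
    rw [PowerSeries.coeff_pow_eq_sum_partition hT, Finset.sum_div]
    refine Finset.sum_congr rfl fun σ hσ => ?_
    rw [symFactor_eq hd, (Finset.mem_filter.mp hσ).2]
    ring
  · intro σ _
    refine Finset.mem_Icc.mpr ⟨len_eq_card σ ▸ len_pos hd σ, ?_⟩
    have h := Multiset.card_nsmul_le_sum (s := σ.parts) (a := 1) fun j hj => σ.parts_pos hj
    rwa [σ.parts_sum, smul_eq_mul, mul_one] at h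

end StarGraph

end

/-- The residue of every star graph with elliptic centre is a rational number `r d σ`, and the
series of their sums over the graphs of degree `d ≥ 1`, in the variable `q = e^x`, is
`χ / 24 · log L̃_0`. -/
theorem proposition2 (k : ℕ) (hk : 2 ≤ k) :
    ∃ r : (d : ℕ) → d.Partition → ℚ,
      (∀ d : ℕ, 1 ≤ d → ∀ σ : d.Partition, StarGraph.starResidue k k σ = (r d σ : StarGraph.K)) ∧
      PowerSeries.mk (fun d : ℕ => if d = 0 then 0 else ∑ σ : d.Partition, r d σ) =
        PowerSeries.C (StarGraph.eulerNumber k k / 24) * PowerSeries.logOf (StarGraph.L0 k) := by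
  refine ⟨fun d σ => StarGraph.symFactor σ * (StarGraph.eulerNumber k k / 24)
      * (σ.parts.map fun j => -PowerSeries.coeff j (StarGraph.L0 k)⁻¹).prod,
    fun d hd σ => StarGraph.starResidue_eq k hk hd σ, ?_⟩
  have h1 := StarGraph.constantCoeff_L0 k
  have hT : PowerSeries.constantCoeff (1 - (StarGraph.L0 k)⁻¹) = 0 := by
    rw [map_sub, map_one, PowerSeries.constantCoeff_inv, h1, inv_one, sub_self]
  ext d
  rw [PowerSeries.coeff_mk, PowerSeries.coeff_C_mul]
  split_ifs with hd
  · rw [hd, PowerSeries.coeff_zero_eq_constantCoeff_apply, PowerSeries.constantCoeff_logOf h1,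
      mul_zero]
  · have h := StarGraph.sum_symFactor_mul hT (Nat.one_le_iff_ne_zero.mpr hd)
    rw [sub_sub_cancel, PowerSeries.logOf_inv h1, map_neg, neg_neg] at h
    rw [← h, Finset.mul_sum]
    refine Finset.sum_congr rfl fun σ _ => ?_
    -- Parts are positive, so the constant term 1 in 1 - L̃_0⁻¹ does not matter.
    have hmap : (σ.parts.map fun j => -PowerSeries.coeff j (StarGraph.L0 k)⁻¹)
        = σ.parts.map fun j => PowerSeries.coeff j (1 - (StarGraph.L0 k)⁻¹) := by
      refine Multiset.map_congr rfl fun j hj => ?_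
      rw [map_sub, PowerSeries.coeff_one, if_neg (σ.parts_pos hj).ne', zero_sub]
    beta_reduce
    rw [hmap]
    ring
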